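/- Let $R$ be a unital ring and work in the category $\mathrm{Mod}\text{-}R$ of right $R$-modules. For a module $T$ let $\mathrm{Gen}(T)$ be the class of epimorphic images of direct sums of copies of $T$, let $\mathrm{Pres}(T)$ be the class of modules $X$ admitting an exact sequence $T^{(J)}\to T^{(I)}\to X\to 0$, let $\mathrm{Add}(T)$ be the class of modules isomorphic to direct summands of direct sums of copies of $T$, and let $T^{\perp}=\{X \mid \mathrm{Ext}^1_R(T,X)=0\}$. The module $T$ is *quasi-tilting* if $\mathrm{Pres}(T)=\mathrm{Gen}(T)\subseteq T^{\perp}$, and *finendo* if it is finitely generated over its endomorphism ring. A *torsion class* is a class of modules closed under epimorphic images, arbitrary direct sums and extensions. For a homomorphism $\sigma:P_{-1}\to P_0$ between projective modules let $\mathcal D_\sigma$ be the class of modules $X$ for which $\mathrm{Hom}_R(\sigma,X)$ is surjective. The module $T$ is *silting* if it has a projective presentation $P_{-1}\xrightarrow{\sigma}P_0\to T\to 0$ such that $\mathcal D_\sigma$ is a torsion class, $T\in\mathcal D_\sigma$, and $\mathcal D_\sigma=\mathrm{Gen}(T)$. Suppose that $R$ is right hereditary (every right ideal is projective) or right perfect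 (every right module has a projective cover). Then for every finendo quasi-tilting module $Q$ there exists a silting module $T$ such that $\mathrm{Add}(Q)=\mathrm{Add}(T)$. Moreover, for every torsion class $\mathcal T\subseteq\mathrm{Mod}\text{-}R$ the following are equivalent: 1. $\mathcal T=\mathrm{Gen}(T)$ for some silting module $T$; 2. $\mathcal T=\mathrm{Gen}(Q)$ for some finendo quasi-tilting module $Q$. -/

import Mathlib

open CategoryTheory

universe u

/-- The category `Mod-R` of right modules over `R`, i.e. of modules over the opposite ring. -/
abbrev RightMod (R : Type u) [Ring R] := ModuleCat.{u} Rᵐᵒᵖ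

/-- `R` is right hereditary: every right ideal is projective as a right `R`-module. -/
def IsRightHereditary (R : Type u) [Ring R] : Prop :=
  ∀ I : Submodule Rᵐᵒᵖ R, Module.Projective Rᵐᵒᵖ I

/-- A submodule `K` of `P` is superfluous if `K + N = P` forces `N = P`. -/
def IsSuperfluousSubmodule {A : Type*} [Ring A] {P : Type*} [AddCommGroup P] [Module A P]
    (K : Submodule A P) : Prop :=
  ∀ N : Submodule A P, K ⊔ N = ⊤ → N = ⊤

/-- `R` is right perfect: every right `R`-module has a projective cover, that is, an epimorphism
from a projective module with superfluous kernel. -/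
def IsRightPerfect (R : Type u) [Ring R] : Prop :=
  ∀ M : RightMod R, ∃ (P : RightMod R) (π : P →ₗ[Rᵐᵒᵖ] M),
    Module.Projective Rᵐᵒᵖ P ∧ Function.Surjective π ∧ IsSuperfluousSubmodule (LinearMap.ker π)

section

variable {R : Type u} [Ring R]

/-- `Gen(T)`: the class of all epimorphic images of direct sums of copies of `T`. -/
def genClass (T : RightMod R) : ObjectProperty (RightMod R) := fun X =>
  ∃ (ι : Type u) (g : (ι →₀ T) →ₗ[Rᵐᵒᵖ] X), Function.Surjective g

/-- `Pres(T)`: the class of all `X` with an exact sequence `T^(κ) → T^(ι) → X → 0`. -/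
def presClass (T : RightMod R) : ObjectProperty (RightMod R) := fun X =>
  ∃ (κ ι : Type u) (f : (κ →₀ T) →ₗ[Rᵐᵒᵖ] (ι →₀ T)) (g : (ι →₀ T) →ₗ[Rᵐᵒᵖ] X),
    Function.Exact f g ∧ Function.Surjective g

/-- `Add(T)`: the class of all modules isomorphic to a direct summand of a direct sum of copies
of `T`. -/
def addClass (T : RightMod R) : ObjectProperty (RightMod R) := fun X =>
  ∃ (ι : Type u) (Y : RightMod R), Nonempty ((X × Y) ≃ₗ[Rᵐᵒᵖ] (ι →₀ T))

/-- `T^⊥`: the class of all `X` with `Ext¹(T, X) = 0`. -/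
def rightPerpClass (T : RightMod R) : ObjectProperty (RightMod R) := fun X =>
  Subsingleton (Abelian.Ext T X 1)

/-- `T` is quasi-tilting: `Pres(T) = Gen(T) ⊆ T^⊥`. -/
def IsQuasiTilting (T : RightMod R) : Prop :=
  presClass T = genClass T ∧ genClass T ≤ rightPerpClass T

/-- `T` is finendo: it is finitely generated as a module over its endomorphism ring, which acts
by evaluation. -/
def IsFinendo (T : RightMod R) : Prop :=
  Module.Finite (Module.End Rᵐᵒᵖ T) T

/-- A torsion class: closed under epimorphic images, arbitrary direct sums (hence containing `0`)
and extensions. -/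
structure IsTorsionClass (𝒯 : ObjectProperty (RightMod R)) : Prop where
  quotients : 𝒯.IsClosedUnderQuotients
  coproducts : ∀ ι : Type u, 𝒯.IsClosedUnderColimitsOfShape (Discrete ι)
  extensions : 𝒯.IsClosedUnderExtensions

/-- `𝒟_σ`: the class of all `X` such that `Hom(σ, X) : Hom(P₀, X) → Hom(P₁, X)` is surjective. -/
def dClass {P₁ P₀ : RightMod R} (σ : P₁ →ₗ[Rᵐᵒᵖ] P₀) : ObjectProperty (RightMod R) := fun X =>
  Function.Surjective (fun φ : P₀ →ₗ[Rᵐᵒᵖ] X => φ.comp σ)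

/-- `σ : P₁ → P₀` is a projective presentation of `T`: `P₁` and `P₀` are projective and there is
an exact sequence `P₁ → P₀ → T → 0` starting with `σ`. -/
def IsProjectivePresentation {P₁ P₀ : RightMod R} (σ : P₁ →ₗ[Rᵐᵒᵖ] P₀) (T : RightMod R) : Prop :=
  Module.Projective Rᵐᵒᵖ P₁ ∧ Module.Projective Rᵐᵒᵖ P₀ ∧
    ∃ π : P₀ →ₗ[Rᵐᵒᵖ] T, Function.Exact σ π ∧ Function.Surjective π

/-- `T` is partial silting with respect to the projective presentation `σ`. -/
def IsPartialSiltingWrt {P₁ P₀ : RightMod R} (σ : P₁ →ₗ[Rᵐᵒᵖ] P₀) (T : RightMod R) : Prop :=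
  IsProjectivePresentation σ T ∧ IsTorsionClass (dClass σ) ∧ dClass σ T

/-- `T` is silting: it is partial silting with respect to some projective presentation `σ` with
`𝒟_σ = Gen(T)`. -/
def IsSilting (T : RightMod R) : Prop :=
  ∃ (P₁ P₀ : RightMod R) (σ : P₁ →ₗ[Rᵐᵒᵖ] P₀),
    IsPartialSiltingWrt σ T ∧ dClass σ = genClass T

end

section

variable {R : Type u} [Ring R]

/-! For finendo quasi-tilting `Q`, the hypothesis on `R` gives the first syzygy of `Q` a projective
cover, hence a projective presentation `α` of `Q` with Gen(Q) ⊆ 𝒟_α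
(`exists_presentation_genClass_le_dClass`). Finiteness over the endomorphism ring gives a map φ from
the regular module to a finite power Qⁿ through which all maps from it into Gen(Q) factor
(`IsFinendo.exists_preenvelope`). Lifting φ to the presentation αⁿ of Qⁿ yields a presentation σ₁ of
C = coker φ, and 𝒟_σ₁ is exactly Gen(Q) (`dClass_coprod_eq`). So C is Ext-projective in Gen(Q),
hence lies in Add(Q) (`addClass_of_genClass`), and T = Qⁿ ⊕ C with presentation αⁿ ⊕ σ₁ is silting
with the same Add and Gen as Q.

Conversely, every silting module is finendo quasi-tilting, over any ring: 𝒟_σ = Gen(T) is closed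
under products and lies in T^⊥, and kernels of canonical maps from sums of copies of T onto its
members stay in it. -/

/-! ### Closure properties of Gen, Pres and Add -/

theorem genClass_iff_iSup_range_eq_top {T X : RightMod R} :
    genClass T X ↔ ⨆ f : T →ₗ[Rᵐᵒᵖ] X, LinearMap.range f = ⊤ := by
  classical
  constructor
  · rintro ⟨ι, g, hg⟩
    rw [eq_top_iff, ← LinearMap.range_eq_top.2 hg]
    rintro _ ⟨x, rfl⟩
    induction x using Finsupp.induction_linear with
    | zero => simp
    | add a b ha hb => rw [map_add]; exact add_mem ha hb
    | single i t =>
      exact Submodule.mem_iSup_of_mem (g.comp (Finsupp.lsingle i)) ⟨t, rfl⟩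
  · intro h
    refine ⟨T →ₗ[Rᵐᵒᵖ] X, Finsupp.lsum ℕ (fun f => f), ?_⟩
    rw [← LinearMap.range_eq_top, eq_top_iff, ← h, iSup_le_iff]
    rintro f _ ⟨t, rfl⟩
    exact ⟨Finsupp.single f t, by simp⟩

theorem range_le_iSup_range_of_genClass {T X Y : RightMod R} (hY : genClass T Y)
    (u : Y →ₗ[Rᵐᵒᵖ] X) : LinearMap.range u ≤ ⨆ f : T →ₗ[Rᵐᵒᵖ] X, LinearMap.range f := by
  rw [← Submodule.map_top, ← genClass_iff_iSup_range_eq_top.1 hY, Submodule.map_iSup,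
    iSup_le_iff]
  intro g
  rw [← LinearMap.range_comp]
  exact le_iSup (fun k : T →ₗ[Rᵐᵒᵖ] X => LinearMap.range k) (u.comp g)

theorem exists_factorization_of_ker_le {M N X : Type*} [AddCommGroup M] [AddCommGroup N]
    [AddCommGroup X] [Module Rᵐᵒᵖ M] [Module Rᵐᵒᵖ N] [Module Rᵐᵒᵖ X] {π : M →ₗ[Rᵐᵒᵖ] N}
    (hπ : Function.Surjective π) (f : M →ₗ[Rᵐᵒᵖ] X)
    (h : LinearMap.ker π ≤ LinearMap.ker f) : ∃ u : N →ₗ[Rᵐᵒᵖ] X, ∀ y, u (π y) = f y := by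
  refine ⟨(LinearMap.ker π).liftQ f h ∘ₗ (π.quotKerEquivOfSurjective hπ).symm.toLinearMap,
    fun y => ?_⟩
  have : (π.quotKerEquivOfSurjective hπ).symm (π y) = Submodule.Quotient.mk y :=
    (π.quotKerEquivOfSurjective hπ).symm_apply_eq.2 rfl
  simp [this]

theorem genClass_of_surjective {T X Y : RightMod R} (f : X →ₗ[Rᵐᵒᵖ] Y)
    (hf : Function.Surjective f) (hX : genClass T X) : genClass T Y := by
  obtain ⟨ι, g, hg⟩ := hX
  exact ⟨ι, f.comp g, hf.comp hg⟩

theorem genClass_finsupp (T : RightMod R) (ι : Type u) :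
    genClass T (ModuleCat.of Rᵐᵒᵖ (ι →₀ T)) :=
  ⟨ι, LinearMap.id, Function.surjective_id⟩

theorem genClass_self (T : RightMod R) : genClass T T :=
  ⟨PUnit, Finsupp.lapply PUnit.unit, fun t => ⟨Finsupp.single PUnit.unit t, by simp⟩⟩

theorem genClass_le_of_genClass {T Q : RightMod R} (h : genClass Q T) :
    genClass T ≤ genClass Q := by
  intro X hX
  rw [genClass_iff_iSup_range_eq_top] at hX ⊢
  rw [eq_top_iff, ← hX, iSup_le_iff]
  exact fun f => range_le_iSup_range_of_genClass h f

theorem presClass_le_genClass (T : RightMod R) : presClass T ≤ genClass T := by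
  rintro X ⟨_, ι, _, g, _, hg⟩
  exact ⟨ι, g, hg⟩

theorem presClass_of_ker {T X : RightMod R} {ι : Type u} (g : (ι →₀ T) →ₗ[Rᵐᵒᵖ] X)
    (hg : Function.Surjective g) (hK : genClass T (ModuleCat.of Rᵐᵒᵖ (LinearMap.ker g))) :
    presClass T X := by
  obtain ⟨κ, f, hf⟩ := hK
  refine ⟨κ, ι, (LinearMap.ker g).subtype.comp f, g, ?_, hg⟩
  rw [LinearMap.exact_iff, LinearMap.range_comp, LinearMap.range_eq_top.2 hf]
  simp

theorem addClass_iff_exists_retraction {T X : RightMod R} :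
    addClass T X ↔ ∃ (ι : Type u) (i : X →ₗ[Rᵐᵒᵖ] (ι →₀ T)) (r : (ι →₀ T) →ₗ[Rᵐᵒᵖ] X),
      r.comp i = LinearMap.id := by
  constructor
  · rintro ⟨ι, Y, ⟨e⟩⟩
    refine ⟨ι, e.toLinearMap.comp (LinearMap.inl _ _ _),
      (LinearMap.fst _ _ _).comp e.symm.toLinearMap, ?_⟩
    ext x
    simp
  · rintro ⟨ι, i, r, h⟩
    have h' : ∀ x, r (i x) = x := fun x => LinearMap.congr_fun h x
    refine ⟨ι, ModuleCat.of Rᵐᵒᵖ (LinearMap.ker r), ⟨LinearEquiv.ofBijective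
      (i.coprod (LinearMap.ker r).subtype) ⟨?_, fun y => ?_⟩⟩⟩
    · rw [← LinearMap.ker_eq_bot, LinearMap.ker_eq_bot']
      rintro ⟨x, y, hy⟩ hxy
      have h1 : i x + y = 0 := by simpa using hxy
      have h2 := congrArg r h1
      rw [map_add, h', LinearMap.mem_ker.1 hy, add_zero, map_zero] at h2
      subst h2
      simp_all
    · refine ⟨(r y, ⟨y - i (r y), ?_⟩), ?_⟩
      · simp [h']
      · simp

theorem addClass_of_retraction {T X Y : RightMod R} (i : X →ₗ[Rᵐᵒᵖ] Y) (r : Y →ₗ[Rᵐᵒᵖ] X)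
    (h : r.comp i = LinearMap.id) (hY : addClass T Y) : addClass T X := by
  rw [addClass_iff_exists_retraction] at *
  obtain ⟨ι, j, s, hs⟩ := hY
  refine ⟨ι, j.comp i, r.comp s, ?_⟩
  rw [LinearMap.comp_assoc, ← LinearMap.comp_assoc i, hs, LinearMap.id_comp, h]

theorem addClass_finsupp {T X : RightMod R} (hX : addClass T X) (κ : Type u) :
    addClass T (ModuleCat.of Rᵐᵒᵖ (κ →₀ X)) := by
  rw [addClass_iff_exists_retraction] at *
  obtain ⟨ι, j, s, hs⟩ := hX
  have hs' : ∀ x, s (j x) = x := fun x => LinearMap.congr_fun hs x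
  refine ⟨κ × ι, (Finsupp.curryLinearEquiv Rᵐᵒᵖ).symm.toLinearMap.comp
    (Finsupp.mapRange.linearMap j), (Finsupp.mapRange.linearMap s).comp
    (Finsupp.curryLinearEquiv Rᵐᵒᵖ).toLinearMap, ?_⟩
  apply LinearMap.ext
  intro x
  apply Finsupp.ext
  intro k
  simp [hs']

theorem addClass_le_of_addClass {T Q : RightMod R} (h : addClass Q T) :
    addClass T ≤ addClass Q := by
  intro X hX
  obtain ⟨ι, i, r, hir⟩ := addClass_iff_exists_retraction.1 hX
  exact addClass_of_retraction (Y := ModuleCat.of Rᵐᵒᵖ (ι →₀ T)) i r hir (addClass_finsupp h ι)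

theorem addClass_prod {T X Y : RightMod R} (hX : addClass T X) (hY : addClass T Y) :
    addClass T (ModuleCat.of Rᵐᵒᵖ (X × Y)) := by
  rw [addClass_iff_exists_retraction] at *
  obtain ⟨ι, i, r, h⟩ := hX
  obtain ⟨κ, j, s, h'⟩ := hY
  refine ⟨ι ⊕ κ, (Finsupp.sumFinsuppLEquivProdFinsupp Rᵐᵒᵖ).symm.toLinearMap.comp (i.prodMap j),
    (r.prodMap s).comp (Finsupp.sumFinsuppLEquivProdFinsupp Rᵐᵒᵖ).toLinearMap, ?_⟩
  have h1 : ∀ x, r (i x) = x := fun x => LinearMap.congr_fun h x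
  have h2 : ∀ x, s (j x) = x := fun x => LinearMap.congr_fun h' x
  apply LinearMap.ext
  rintro ⟨x, y⟩
  simp [h1, h2]

theorem addClass_self (T : RightMod R) : addClass T T :=
  addClass_iff_exists_retraction.2 ⟨PUnit, Finsupp.lsingle PUnit.unit, Finsupp.lapply PUnit.unit,
    by ext; simp⟩

/-! ### Vanishing of Ext¹ as extension of homomorphisms -/

/-- A surjection and the inclusion of its kernel form a short exact sequence. -/
theorem shortExact_ker_subtype {E M : RightMod R} (p : E →ₗ[Rᵐᵒᵖ] M)
    (hp : Function.Surjective p) :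
    (ShortComplex.mk (ModuleCat.ofHom (LinearMap.ker p).subtype) (ModuleCat.ofHom p)
      (by ext x; exact x.2)).ShortExact :=
  { exact := by
      rw [ShortComplex.ShortExact.moduleCat_exact_iff_function_exact]
      exact LinearMap.exact_subtype_ker_map p
    mono_f := (ModuleCat.mono_iff_injective _).2 (Submodule.injective_subtype _)
    epi_g := (ModuleCat.epi_iff_surjective _).2 hp }

theorem exists_extension_of_rightPerpClass {E M X : RightMod R} (h : rightPerpClass M X)
    (p : E →ₗ[Rᵐᵒᵖ] M) (hp : Function.Surjective p) (g : LinearMap.ker p →ₗ[Rᵐᵒᵖ] X) :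
    ∃ f : E →ₗ[Rᵐᵒᵖ] X, f.comp (LinearMap.ker p).subtype = g := by
  have : Subsingleton (Abelian.Ext M X 1) := h
  obtain ⟨x, hx⟩ := Abelian.Ext.contravariant_sequence_exact₁ (shortExact_ker_subtype p hp) X
    (Abelian.Ext.mk₀ (ModuleCat.ofHom g)) (n₁ := 1) rfl (Subsingleton.elim _ _)
  obtain ⟨f, rfl⟩ := (Abelian.Ext.mk₀_bijective _ _).2 x
  rw [Abelian.Ext.mk₀_comp_mk₀] at hx
  have := (Abelian.Ext.mk₀_bijective _ _).1 hx
  exact ⟨f.hom, congrArg ModuleCat.Hom.hom this⟩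

theorem rightPerpClass_of_exists_extension {P M X : RightMod R} [Module.Projective Rᵐᵒᵖ P]
    (p : P →ₗ[Rᵐᵒᵖ] M) (hp : Function.Surjective p)
    (h : ∀ g : LinearMap.ker p →ₗ[Rᵐᵒᵖ] X,
      ∃ f : P →ₗ[Rᵐᵒᵖ] X, f.comp (LinearMap.ker p).subtype = g) :
    rightPerpClass M X := by
  have : Projective P := (IsProjective.iff_projective (R := Rᵐᵒᵖ) P).1 inferInstance
  refine subsingleton_of_forall_eq 0 fun e => ?_
  obtain ⟨x, rfl⟩ := Abelian.Ext.contravariant_sequence_exact₃ (shortExact_ker_subtype p hp) X e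
    (@Abelian.Ext.eq_zero_of_projective _ _ _ _ P X 0 this _) (n₀ := 0) rfl
  obtain ⟨g, rfl⟩ := (Abelian.Ext.mk₀_bijective _ _).2 x
  obtain ⟨f, hf⟩ := h g.hom
  have hg : g = ModuleCat.ofHom (LinearMap.ker p).subtype ≫ ModuleCat.ofHom f := by
    ext x
    exact (LinearMap.congr_fun hf x).symm
  subst hg
  rw [← Abelian.Ext.mk₀_comp_mk₀]
  exact ShortComplex.ShortExact.extClass_comp_assoc (shortExact_ker_subtype p hp) _

theorem dClass_le_rightPerpClass {P₁ P₀ T : RightMod R} {σ : P₁ →ₗ[Rᵐᵒᵖ] P₀}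
    (hσ : IsProjectivePresentation σ T) : dClass σ ≤ rightPerpClass T := by
  obtain ⟨_, _, π, hex, hπ⟩ := hσ
  intro X hX
  refine rightPerpClass_of_exists_extension π hπ fun g => ?_
  have hσk : ∀ x, σ x ∈ LinearMap.ker π := fun x => hex.apply_apply_eq_zero x
  obtain ⟨f, hf⟩ := hX (g.comp (σ.codRestrict _ hσk))
  refine ⟨f, ?_⟩
  ext ⟨y, hy⟩
  obtain ⟨x, rfl⟩ := (hex y).1 hy
  exact LinearMap.congr_fun hf x

/-! ### Torsion class properties of Gen(T) and 𝒟_σ -/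

theorem genClass_isClosedUnderQuotients (T : RightMod R) :
    (genClass T).IsClosedUnderQuotients :=
  ⟨fun f hf hX => genClass_of_surjective f.hom ((ModuleCat.epi_iff_surjective f).1 hf) hX⟩

theorem genClass_isClosedUnderColimitsOfShape (T : RightMod R) (J : Type u) [SmallCategory J] :
    (genClass T).IsClosedUnderColimitsOfShape J := by
  refine ⟨?_⟩
  rintro X ⟨c⟩
  rw [genClass_iff_iSup_range_eq_top]
  set N : Submodule Rᵐᵒᵖ X := ⨆ f : T →ₗ[Rᵐᵒᵖ] X, LinearMap.range f with hN
  -- The quotient by the trace of `T` kills every leg of the colimit cocone, hence vanishes.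
  have h0 : ModuleCat.ofHom N.mkQ = ModuleCat.ofHom (0 : X →ₗ[Rᵐᵒᵖ] (X ⧸ N)) := by
    refine c.isColimit.hom_ext fun j => ?_
    ext x
    have : (c.ι.app j).hom x ∈ N :=
      range_le_iSup_range_of_genClass (c.prop_diag_obj j) (c.ι.app j).hom ⟨x, rfl⟩
    exact (Submodule.Quotient.mk_eq_zero N).2 this
  have h1 : N.mkQ = 0 := congrArg ModuleCat.Hom.hom h0
  rw [← N.ker_mkQ, h1, LinearMap.ker_zero]

theorem dClass_isClosedUnderExtensions {P₁ P₀ : RightMod R} (σ : P₁ →ₗ[Rᵐᵒᵖ] P₀)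
    [Module.Projective Rᵐᵒᵖ P₀] : (dClass σ).IsClosedUnderExtensions := by
  refine ⟨fun {S} hS h₁ h₃ g => ?_⟩
  have hg : Function.Surjective S.g.hom := (ModuleCat.epi_iff_surjective _).1 hS.epi_g
  have hf : Function.Injective S.f.hom := (ModuleCat.mono_iff_injective _).1 hS.mono_f
  have hex : Function.Exact S.f.hom S.g.hom :=
    (ShortComplex.ShortExact.moduleCat_exact_iff_function_exact S).1 hS.exact
  obtain ⟨h, hh⟩ := h₃ (S.g.hom.comp g)
  obtain ⟨h', hh'⟩ := Module.projective_lifting_property S.g.hom h hg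
  have hk : ∀ x, ∃ y, S.f.hom y = (g - h'.comp σ) x := fun x => (hex _).1 <| by
    have e1 := LinearMap.congr_fun hh x
    have e2 := LinearMap.congr_fun hh' (σ x)
    simp only [LinearMap.comp_apply] at e1 e2
    simp [e1, e2]
  let k : P₁ →ₗ[Rᵐᵒᵖ] S.X₁ := (LinearEquiv.ofInjective S.f.hom hf).symm.toLinearMap.comp
    ((g - h'.comp σ).codRestrict (LinearMap.range S.f.hom) hk)
  have hfk : ∀ x, S.f.hom (k x) = (g - h'.comp σ) x := fun x =>
    congrArg Subtype.val ((LinearEquiv.ofInjective S.f.hom hf).apply_symm_apply ⟨_, hk x⟩)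
  obtain ⟨l, hl⟩ := h₁ k
  refine ⟨h' + S.f.hom.comp l, ?_⟩
  ext x
  have e := LinearMap.congr_fun hl x
  simp only [LinearMap.comp_apply] at e
  simp [e, hfk]

theorem isTorsionClass_of_dClass_eq_genClass {P₁ P₀ T : RightMod R} {σ : P₁ →ₗ[Rᵐᵒᵖ] P₀}
    [Module.Projective Rᵐᵒᵖ P₀] (h : dClass σ = genClass T) : IsTorsionClass (dClass σ) where
  quotients := h ▸ genClass_isClosedUnderQuotients T
  coproducts ι := h ▸ genClass_isClosedUnderColimitsOfShape T (Discrete ι)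
  extensions := dClass_isClosedUnderExtensions σ

/-! ### Silting modules are finendo quasi-tilting -/

theorem IsSilting.isQuasiTilting {T : RightMod R} (hT : IsSilting T) : IsQuasiTilting T := by
  obtain ⟨P₁, P₀, σ, ⟨hσ, -, -⟩, hD⟩ := hT
  refine ⟨le_antisymm (presClass_le_genClass T) fun X hX => ?_,
    hD ▸ dClass_le_rightPerpClass hσ⟩
  obtain ⟨_, _, π, hex, hπ⟩ := hσ
  let p : ((T →ₗ[Rᵐᵒᵖ] X) →₀ T) →ₗ[Rᵐᵒᵖ] X := Finsupp.lsum ℕ (fun f => f)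
  have hp : Function.Surjective p := by
    rw [← LinearMap.range_eq_top, eq_top_iff, ← genClass_iff_iSup_range_eq_top.1 hX, iSup_le_iff]
    rintro f _ ⟨t, rfl⟩
    exact ⟨Finsupp.single f t, by simp [p]⟩
  refine presClass_of_ker p hp ?_
  rw [← hD]
  intro g
  have hmem : dClass σ (ModuleCat.of Rᵐᵒᵖ ((T →ₗ[Rᵐᵒᵖ] X) →₀ T)) := by
    rw [hD]; exact genClass_finsupp T _
  obtain ⟨h, hh⟩ := hmem ((LinearMap.ker p).subtype.comp g)
  have hh' : ∀ x, h (σ x) = g x := fun x => LinearMap.congr_fun hh x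
  have hker : LinearMap.ker π ≤ LinearMap.ker (p.comp h) := by
    intro y hy
    obtain ⟨x, rfl⟩ := (hex y).1 hy
    simp [hh']
  obtain ⟨u, hu⟩ := exists_factorization_of_ker_le hπ (p.comp h) hker
  -- The sum is indexed by all of Hom(T, X), so `u` is itself an index. Subtracting the copy of `π`
  -- at `u` pushes `h` into the kernel of `p` without changing it on the image of `σ`.
  refine ⟨(h - (Finsupp.lsingle u).comp π).codRestrict (LinearMap.ker p) fun y => ?_, ?_⟩
  · have hs : p (Finsupp.single u (π y)) = p (h y) := (by simp [p, hu])
    rw [LinearMap.mem_ker, LinearMap.sub_apply, map_sub, sub_eq_zero]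
    exact hs.symm
  · refine LinearMap.ext fun x => Subtype.ext ?_
    simp [hh', hex.apply_apply_eq_zero]

theorem IsSilting.isFinendo {T : RightMod R} (hT : IsSilting T) : IsFinendo T := by
  obtain ⟨P₁, P₀, σ, ⟨-, -, hTD⟩, hD⟩ := hT
  have hprod : dClass σ (ModuleCat.of Rᵐᵒᵖ (T → T)) := by
    intro g
    choose f hf using fun t : T => hTD ((LinearMap.proj t).comp g)
    refine ⟨LinearMap.pi f, ?_⟩
    ext x t
    exact LinearMap.congr_fun (hf t) x
  rw [hD] at hprod
  obtain ⟨ι, g, hg⟩ := hprod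
  -- The identity is the element of the product T^T whose coordinate at t is t. The finitely many
  -- entries of a preimage `y` generate `T`: each t is a sum of endomorphisms applied to them.
  obtain ⟨y, hy⟩ := hg (id : T → T)
  classical
  refine ⟨⟨y.support.image y, ?_⟩⟩
  rw [eq_top_iff]
  intro t _
  have ht : t = ∑ i ∈ y.support,
      (((LinearMap.proj t).comp (g.comp (Finsupp.lsingle i)) : Module.End Rᵐᵒᵖ T)) • y i := by
    have h1 := congrFun hy t
    conv_lhs at h1 => rw [← Finsupp.sum_single y, Finsupp.sum, map_sum, Finset.sum_apply]
    exact h1.symm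
  rw [ht]
  refine Submodule.sum_mem _ fun i hi => Submodule.smul_mem _ _ (Submodule.subset_span ?_)
  simpa using ⟨i, by simpa using hi, rfl⟩

/-! ### Hereditary and perfect rings: covers of syzygies -/

/-- Over a right hereditary ring, quotients of injective right modules are injective. -/
theorem IsRightHereditary.injective_of_surjective (hR : IsRightHereditary R) {E F : RightMod R}
    (hE : Module.Injective Rᵐᵒᵖ E) (p : E →ₗ[Rᵐᵒᵖ] F) (hp : Function.Surjective p) :
    Module.Injective Rᵐᵒᵖ F := by
  refine Module.Baer.injective fun I g => ?_
  let e : R ≃ₗ[Rᵐᵒᵖ] Rᵐᵒᵖ :=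
    { MulOpposite.opAddEquiv with map_smul' := fun r x => by simp }
  have : Module.Projective Rᵐᵒᵖ (Submodule.comap e.toLinearMap I) := hR _
  have hmap : Submodule.map e.toLinearMap (Submodule.comap e.toLinearMap I) = I :=
    Submodule.map_comap_eq_of_surjective e.surjective I
  have : Module.Projective Rᵐᵒᵖ I := Module.Projective.of_equiv
    ((e.submoduleMap (Submodule.comap e.toLinearMap I)).trans (LinearEquiv.ofEq _ _ hmap))
  obtain ⟨f, hf⟩ := Module.projective_lifting_property p g hp
  obtain ⟨f', hf'⟩ := Module.Baer.of_injective hE I f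
  refine ⟨p.comp f', fun x hx => ?_⟩
  rw [LinearMap.comp_apply, hf' x hx]
  exact LinearMap.congr_fun hf ⟨x, hx⟩

theorem exists_injective_embedding (M : RightMod R) :
    ∃ (E : RightMod R) (i : M →ₗ[Rᵐᵒᵖ] E), Module.Injective Rᵐᵒᵖ E ∧ Function.Injective i := by
  obtain ⟨J, hJ, f, hf⟩ := EnoughInjectives.presentation M
  exact ⟨J, f.hom, Module.injective_module_of_injective_object Rᵐᵒᵖ J,
    (ModuleCat.mono_iff_injective f).1 hf⟩

/-- Over a right hereditary ring, submodules of projective right modules are projective. -/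
theorem IsRightHereditary.projective_submodule (hR : IsRightHereditary R) {P : RightMod R}
    [Module.Projective Rᵐᵒᵖ P] (K : Submodule Rᵐᵒᵖ P) : Module.Projective Rᵐᵒᵖ K := by
  refine (IsProjective.iff_projective (R := Rᵐᵒᵖ) K).2 ⟨fun {B' B} f q hq => ?_⟩
  obtain ⟨E, i, hE, hi⟩ := exists_injective_embedding B'
  let N : Submodule Rᵐᵒᵖ E := (LinearMap.ker q.hom).map i
  have hE' : Module.Injective Rᵐᵒᵖ (E ⧸ N) :=
    hR.injective_of_surjective (F := ModuleCat.of Rᵐᵒᵖ (E ⧸ N)) hE N.mkQ N.mkQ_surjective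
  have hq' : Function.Surjective q.hom := (ModuleCat.epi_iff_surjective q).1 hq
  obtain ⟨j, hj⟩ := exists_factorization_of_ker_le hq' (N.mkQ.comp i) fun b hb => by
    simpa using (Submodule.Quotient.mk_eq_zero N).2 (Submodule.mem_map_of_mem hb)
  replace hj : ∀ b, j (q.hom b) = N.mkQ (i b) := hj
  -- B = B'/ker q embeds in the injective module E/N, so the map from `K` extends to `P` and then
  -- lifts to `E`. On `K` the lift lands in B' because modulo `N` it comes from B.
  obtain ⟨u, hu⟩ := hE'.out K.subtype K.injective_subtype (j.comp f.hom)
  obtain ⟨v, hv⟩ := Module.projective_lifting_property N.mkQ u N.mkQ_surjective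
  have hmem : ∀ x : K, v x ∈ LinearMap.range i := by
    intro x
    obtain ⟨b, hb⟩ := hq' (f.hom x)
    have h1 : N.mkQ (v x) = N.mkQ (i b) := by
      rw [← hj, hb]
      exact (LinearMap.congr_fun hv x).trans (hu x)
    obtain ⟨c, -, hc⟩ := (Submodule.Quotient.eq N).1 h1
    exact ⟨c + b, by rw [map_add, hc, sub_add_cancel]⟩
  let w : K →ₗ[Rᵐᵒᵖ] B' := (LinearEquiv.ofInjective i hi).symm.toLinearMap.comp
    ((v.comp K.subtype).codRestrict _ hmem)
  have hw : ∀ x, i (w x) = v x := fun x =>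
    congrArg Subtype.val ((LinearEquiv.ofInjective i hi).apply_symm_apply ⟨_, hmem x⟩)
  refine ⟨ModuleCat.ofHom w, ?_⟩
  ext x
  obtain ⟨b, hb⟩ := hq' (f.hom x)
  have h1 : N.mkQ (i (w x)) = N.mkQ (i b) := by
    rw [hw, ← hj, hb]
    exact (LinearMap.congr_fun hv x).trans (hu x)
  obtain ⟨c, hc, hc'⟩ := (Submodule.Quotient.eq N).1 h1
  have h2 : c = w x - b := hi (by rw [hc', map_sub])
  subst h2
  have h3 : q.hom (w x - b) = 0 := hc
  rw [map_sub, sub_eq_zero, hb] at h3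
  exact h3

theorem exists_projective_surjection (M : RightMod R) :
    ∃ (P : RightMod R) (π : P →ₗ[Rᵐᵒᵖ] M),
      Module.Projective Rᵐᵒᵖ P ∧ Function.Surjective π :=
  ⟨ModuleCat.of Rᵐᵒᵖ (M →₀ Rᵐᵒᵖ), Finsupp.linearCombination Rᵐᵒᵖ id, inferInstance,
    Finsupp.linearCombination_id_surjective Rᵐᵒᵖ M⟩

/-- The sole point where the hypothesis on `R` enters. In the hereditary case the submodule is its
own cover. -/
theorem exists_projective_cover_submodule
    (hR : IsRightHereditary R ∨ IsRightPerfect R) {P : RightMod R} [Module.Projective Rᵐᵒᵖ P]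
    (K : Submodule Rᵐᵒᵖ P) :
    ∃ (P' : RightMod R) (π : P' →ₗ[Rᵐᵒᵖ] K),
      Module.Projective Rᵐᵒᵖ P' ∧ Function.Surjective π ∧
        IsSuperfluousSubmodule (LinearMap.ker π) := by
  rcases hR with hR | hR
  · exact ⟨ModuleCat.of Rᵐᵒᵖ K, LinearMap.id, hR.projective_submodule K,
      Function.surjective_id, fun N hN => by simpa using hN⟩
  · exact hR (ModuleCat.of Rᵐᵒᵖ K)

/-- If `Gen(Q) ⊆ M^⊥`, then `M` has a projective presentation `α` with `Gen(Q) ⊆ 𝒟_α`. -/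
theorem exists_presentation_genClass_le_dClass (hR : IsRightHereditary R ∨ IsRightPerfect R)
    {Q M : RightMod R} (h : genClass Q ≤ rightPerpClass M) :
    ∃ (P₁ P₀ : RightMod R) (α : P₁ →ₗ[Rᵐᵒᵖ] P₀),
      IsProjectivePresentation α M ∧ genClass Q ≤ dClass α := by
  obtain ⟨P₀, π, hP₀, hπ⟩ := exists_projective_surjection M
  obtain ⟨P₁, p, hP₁, hp, hs⟩ :=
    exists_projective_cover_submodule hR (LinearMap.ker π)
  have hext : ∀ {X : RightMod R}, genClass Q X → ∀ g : P₁ →ₗ[Rᵐᵒᵖ] X,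
      LinearMap.ker p ≤ LinearMap.ker g → ∃ f : P₀ →ₗ[Rᵐᵒᵖ] X, ∀ x, f (p x) = g x := by
    intro X hX g hg
    obtain ⟨u, hu⟩ := exists_factorization_of_ker_le hp g hg
    obtain ⟨f, hf⟩ := exists_extension_of_rightPerpClass (h X hX) π hπ u
    exact ⟨f, fun x => (LinearMap.congr_fun hf (p x)).trans (hu x)⟩
  refine ⟨P₁, P₀, (LinearMap.ker π).subtype.comp p, ⟨hP₁, hP₀, π, ?_, hπ⟩, fun X hX g => ?_⟩
  · rw [LinearMap.exact_iff, LinearMap.range_comp, LinearMap.range_eq_top.2 hp]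
    simp
  -- `g` need not factor through `p`, but it does modulo the image `N` of ker p, and X/N stays in
  -- Gen(Q). The extension obtained there lifts to `X`, with an error on P₁ lying in g(ker p). Hence
  -- ker p and the kernel of the error span P₁, and superfluousness makes the error zero.
  let N : Submodule Rᵐᵒᵖ X := (LinearMap.ker p).map g
  obtain ⟨f, hf⟩ := hext (X := ModuleCat.of Rᵐᵒᵖ (X ⧸ N))
    (genClass_of_surjective N.mkQ N.mkQ_surjective hX) (N.mkQ.comp g) (fun x hx => by
      simpa using (Submodule.Quotient.mk_eq_zero N).2 (Submodule.mem_map_of_mem hx))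
  obtain ⟨f', hf'⟩ := Module.projective_lifting_property N.mkQ f N.mkQ_surjective
  have hker : LinearMap.ker (g - f'.comp ((LinearMap.ker π).subtype.comp p)) = ⊤ := by
    refine hs _ (eq_top_iff.2 fun x _ => ?_)
    have h1 : N.mkQ (g x) = N.mkQ (f' (p x)) :=
      (hf x).symm.trans (LinearMap.congr_fun hf' _).symm
    obtain ⟨y, hy, hy'⟩ := (Submodule.Quotient.eq N).1 h1
    rw [← add_sub_cancel y x]
    refine Submodule.add_mem_sup hy ?_
    have hy0 : p y = 0 := hy
    simp [hy', hy0]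
  refine ⟨f', ?_⟩
  rw [LinearMap.ker_eq_top, sub_eq_zero] at hker
  exact hker.symm

/-! ### Sums and cokernels of presentations -/

theorem IsProjectivePresentation.prod {P₁ P₀ T P₁' P₀' T' : RightMod R} {σ : P₁ →ₗ[Rᵐᵒᵖ] P₀}
    {σ' : P₁' →ₗ[Rᵐᵒᵖ] P₀'} (h : IsProjectivePresentation σ T)
    (h' : IsProjectivePresentation σ' T') :
    IsProjectivePresentation (P₁ := ModuleCat.of Rᵐᵒᵖ (P₁ × P₁'))
      (P₀ := ModuleCat.of Rᵐᵒᵖ (P₀ × P₀')) (σ.prodMap σ') (ModuleCat.of Rᵐᵒᵖ (T × T')) := by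
  obtain ⟨h₁, h₀, π, hex, hπ⟩ := h
  obtain ⟨h₁', h₀', π', hex', hπ'⟩ := h'
  refine ⟨inferInstanceAs (Module.Projective Rᵐᵒᵖ (P₁ × P₁')),
    inferInstanceAs (Module.Projective Rᵐᵒᵖ (P₀ × P₀')), π.prodMap π', ?_, hπ.prodMap hπ'⟩
  rintro ⟨x, y⟩
  constructor
  · intro hxy
    obtain ⟨a, rfl⟩ := (hex x).1 (congrArg Prod.fst hxy)
    obtain ⟨b, rfl⟩ := (hex' y).1 (congrArg Prod.snd hxy)
    exact ⟨(a, b), rfl⟩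
  · rintro ⟨⟨a, b⟩, hab⟩
    rw [← hab]
    exact Prod.ext (hex.apply_apply_eq_zero a) (hex'.apply_apply_eq_zero b)

theorem dClass_prodMap_iff {P₁ P₀ P₁' P₀' : RightMod R} (σ : P₁ →ₗ[Rᵐᵒᵖ] P₀)
    (σ' : P₁' →ₗ[Rᵐᵒᵖ] P₀') (X : RightMod R) :
    dClass (P₁ := ModuleCat.of Rᵐᵒᵖ (P₁ × P₁')) (P₀ := ModuleCat.of Rᵐᵒᵖ (P₀ × P₀'))
      (σ.prodMap σ') X ↔ dClass σ X ∧ dClass σ' X := by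
  constructor
  · intro h
    constructor
    · intro g
      obtain ⟨f, hf⟩ := h (g.coprod (0 : P₁' →ₗ[Rᵐᵒᵖ] X))
      refine ⟨f.comp (LinearMap.inl Rᵐᵒᵖ P₀ P₀'), ?_⟩
      ext x
      simpa using LinearMap.congr_fun hf ((x, 0) : P₁ × P₁')
    · intro g
      obtain ⟨f, hf⟩ := h ((0 : P₁ →ₗ[Rᵐᵒᵖ] X).coprod g)
      refine ⟨f.comp (LinearMap.inr Rᵐᵒᵖ P₀ P₀'), ?_⟩
      ext x
      simpa using LinearMap.congr_fun hf ((0, x) : P₁ × P₁')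
  · rintro ⟨h, h'⟩ g
    obtain ⟨f, hf⟩ := h (g.comp (LinearMap.inl Rᵐᵒᵖ P₁ P₁'))
    obtain ⟨f', hf'⟩ := h' (g.comp (LinearMap.inr Rᵐᵒᵖ P₁ P₁'))
    refine ⟨f.coprod f', LinearMap.ext ?_⟩
    rintro ⟨x, y⟩
    have e1 := LinearMap.congr_fun hf x
    have e2 := LinearMap.congr_fun hf' y
    have e3 : g (x, y) = g (x, 0) + g (0, y) := by rw [← map_add]; congr 1; ext <;> simp
    simp only [LinearMap.comp_apply, LinearMap.inl_apply, LinearMap.inr_apply] at e1 e2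
    simp [e1, e2, e3]

theorem IsProjectivePresentation.finsupp {P₁ P₀ T : RightMod R} {σ : P₁ →ₗ[Rᵐᵒᵖ] P₀}
    (h : IsProjectivePresentation σ T) (ι : Type u) :
    IsProjectivePresentation (P₁ := ModuleCat.of Rᵐᵒᵖ (ι →₀ P₁))
      (P₀ := ModuleCat.of Rᵐᵒᵖ (ι →₀ P₀)) (Finsupp.mapRange.linearMap σ)
      (ModuleCat.of Rᵐᵒᵖ (ι →₀ T)) := by
  classical
  obtain ⟨h₁, h₀, π, hex, hπ⟩ := h
  refine ⟨Module.Projective.of_equiv (finsuppLequivDFinsupp Rᵐᵒᵖ).symm,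
    Module.Projective.of_equiv (finsuppLequivDFinsupp Rᵐᵒᵖ).symm,
    Finsupp.mapRange.linearMap π, fun y => ⟨fun hy => ?_, ?_⟩,
    Finsupp.mapRange_surjective _ (map_zero π) hπ⟩
  · change y ∈ LinearMap.range (Finsupp.mapRange.linearMap σ)
    rw [← Finsupp.sum_single y]
    refine Submodule.sum_mem _ fun i _ => ?_
    obtain ⟨x, hx⟩ := (hex (y i)).1 (by simpa using DFunLike.congr_fun hy i)
    exact ⟨Finsupp.single i x, by simp [hx]⟩
  · rintro ⟨x, rfl⟩
    ext i
    simpa using hex.apply_apply_eq_zero (x i)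

theorem dClass_mapRange_iff {P₁ P₀ : RightMod R} (σ : P₁ →ₗ[Rᵐᵒᵖ] P₀) (ι : Type u) [Nonempty ι]
    (X : RightMod R) :
    dClass (P₁ := ModuleCat.of Rᵐᵒᵖ (ι →₀ P₁)) (P₀ := ModuleCat.of Rᵐᵒᵖ (ι →₀ P₀))
      (Finsupp.mapRange.linearMap σ) X ↔ dClass σ X := by
  constructor
  · intro h g
    obtain ⟨i⟩ := ‹Nonempty ι›
    obtain ⟨f, hf⟩ := h (Finsupp.lsum ℕ (fun _ : ι => g))
    refine ⟨f.comp (Finsupp.lsingle i), ?_⟩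
    ext x
    simpa using LinearMap.congr_fun hf (Finsupp.single i x)
  · intro h g
    choose f hf using fun i : ι => h (g.comp (Finsupp.lsingle i))
    refine ⟨Finsupp.lsum ℕ f, Finsupp.lhom_ext fun i x => ?_⟩
    have := LinearMap.congr_fun (hf i) x
    simpa using this

/-- The presentation of the cokernel of `φ : P → M` induced by a presentation of `M` and a lift
of `φ`. -/
theorem IsProjectivePresentation.coprod {P P₁ P₀ M : RightMod R} [Module.Projective Rᵐᵒᵖ P]
    {α : P₁ →ₗ[Rᵐᵒᵖ] P₀} (hP₁ : Module.Projective Rᵐᵒᵖ P₁) (hP₀ : Module.Projective Rᵐᵒᵖ P₀)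
    {π : P₀ →ₗ[Rᵐᵒᵖ] M} (hex : Function.Exact α π) (hπ : Function.Surjective π)
    (φ : P →ₗ[Rᵐᵒᵖ] P₀) :
    IsProjectivePresentation (P₁ := ModuleCat.of Rᵐᵒᵖ (P × P₁)) (φ.coprod α)
      (ModuleCat.of Rᵐᵒᵖ (M ⧸ LinearMap.range (π.comp φ))) := by
  refine ⟨inferInstanceAs (Module.Projective Rᵐᵒᵖ (P × P₁)), hP₀,
    (LinearMap.range (π.comp φ)).mkQ.comp π, ?_, (Submodule.mkQ_surjective _).comp hπ⟩
  intro y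
  constructor
  · intro hy
    obtain ⟨x, hx⟩ := (Submodule.Quotient.mk_eq_zero (LinearMap.range (π.comp φ))).1 hy
    have h0 : π (y - φ x) = 0 := by rw [map_sub, ← hx]; simp
    obtain ⟨z, hz⟩ := (hex _).1 h0
    exact ⟨(x, z), by simp [hz]⟩
  · rintro ⟨⟨x, z⟩, rfl⟩
    refine (Submodule.Quotient.mk_eq_zero _).2 ⟨x, ?_⟩
    simp [hex.apply_apply_eq_zero]

/-! ### From finendo quasi-tilting to silting -/

/-- Pres = Gen provides a cover of `M` by a sum of copies of `Q` whose kernel is in Gen(Q). Ext¹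
from `M` to that kernel vanishes, so the cover splits. -/
theorem addClass_of_genClass {Q M : RightMod R} (hQ : presClass Q = genClass Q)
    (hM : genClass Q M) (hperp : genClass Q ≤ rightPerpClass M) : addClass Q M := by
  rw [← hQ] at hM
  obtain ⟨κ, ι, f, g, hex, hg⟩ := hM
  have hK : genClass Q (ModuleCat.of Rᵐᵒᵖ (LinearMap.ker g)) :=
    ⟨κ, f.codRestrict _ hex.apply_apply_eq_zero, fun ⟨y, hy⟩ => by
      obtain ⟨x, rfl⟩ := (hex y).1 hy
      exact ⟨x, rfl⟩⟩
  obtain ⟨r, hr⟩ := exists_extension_of_rightPerpClass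
    (E := ModuleCat.of Rᵐᵒᵖ (ι →₀ Q)) (hperp _ hK) g hg LinearMap.id
  have hr' : ∀ k (hk : k ∈ LinearMap.ker g), (r k : ι →₀ Q) = k := fun k hk =>
    congrArg Subtype.val (LinearMap.congr_fun hr ⟨k, hk⟩)
  obtain ⟨s, hs⟩ := exists_factorization_of_ker_le hg
    (LinearMap.id - (LinearMap.ker g).subtype.comp r) fun y hy => by simp [hr' y hy]
  refine addClass_iff_exists_retraction.2 ⟨ι, s, g, LinearMap.ext fun y => ?_⟩
  obtain ⟨x, rfl⟩ := hg y
  have : g (r x) = 0 := (r x).2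
  simp [hs, this]

/-- A finendo module `Q` admits a map from `R` into a finite direct power of `Q`, given by a
generating family over the endomorphism ring, through which every map to `Gen(Q)` factors. -/
theorem IsFinendo.exists_preenvelope {Q : RightMod R} (hQ : IsFinendo Q) :
    ∃ (ι : Type u) (_ : Nonempty ι) (φ : Rᵐᵒᵖ →ₗ[Rᵐᵒᵖ] (ι →₀ Q)),
      ∀ X : RightMod R, genClass Q X → ∀ g : Rᵐᵒᵖ →ₗ[Rᵐᵒᵖ] X,
        ∃ f : (ι →₀ Q) →ₗ[Rᵐᵒᵖ] X, f.comp φ = g := by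
  classical
  obtain ⟨⟨S, hS⟩⟩ := hQ
  -- Adjoining 0 to the generators keeps the index set nonempty, so that `Q` is a summand of the
  -- power.
  let ι : Type u := {x // x ∈ insert (0 : Q) S}
  let a : ι →₀ Q := Finsupp.equivFunOnFinite.symm (fun i => i.1)
  refine ⟨ι, ⟨⟨0, Finset.mem_insert_self _ _⟩⟩, LinearMap.toSpanSingleton Rᵐᵒᵖ _ a, ?_⟩
  have key : ∀ {X : RightMod R}, genClass Q X → ∀ x : X,
      ∃ f : (ι →₀ Q) →ₗ[Rᵐᵒᵖ] X, f a = x := by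
    intro X hX x
    let N : Submodule ℤ X := LinearMap.range
      ({ toFun := fun f => f a, map_zero' := rfl, map_add' := fun _ _ => rfl } :
        ((ι →₀ Q) →ₗ[Rᵐᵒᵖ] X) →+ X).toIntLinearMap
    -- The map `u` is quantified inside the induction so that an endomorphism acting on the element
    -- can be absorbed into it.
    have hNq : ∀ (q : Q) (u : Q →ₗ[Rᵐᵒᵖ] X), u q ∈ N := by
      intro q
      have hq : q ∈ Submodule.span (Module.End Rᵐᵒᵖ Q) (S : Set Q) := hS ▸ Submodule.mem_top
      induction hq using Submodule.span_induction with
      | mem q hq =>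
        exact fun u => ⟨u.comp (Finsupp.lapply ⟨q, Finset.mem_insert_of_mem hq⟩), by simp [a]⟩
      | zero => exact fun u => by simp
      | add x y _ _ hx hy => exact fun u => by rw [map_add]; exact add_mem (hx u) (hy u)
      | smul e x _ hx => exact fun u => hx (u.comp e)
    obtain ⟨κ, p, hp⟩ := hX
    have hN : x ∈ N := by
      obtain ⟨y, rfl⟩ := hp x
      induction y using Finsupp.induction_linear with
      | zero => simp
      | add b c hb hc => rw [map_add]; exact add_mem hb hc
      | single i t => exact hNq t (p.comp (Finsupp.lsingle i))
    exact hN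
  intro X hX g
  obtain ⟨f, hf⟩ := key hX (g 1)
  refine ⟨f, LinearMap.ext_ring ?_⟩
  simp [hf]

/-- For `X` in 𝒟 and x in `X`, extend the map sending 1 to x and killing P₁: it vanishes on the
image of `α`, so it factors through a power of `Q` and puts x in the trace. For `X` in Gen(Q),
extend first along `α`, then correct on the regular module by a map factoring through `π`, which
leaves the P₁ component alone. -/
theorem dClass_coprod_eq {Q P₁ P₀ : RightMod R} {ι : Type u} {α : P₁ →ₗ[Rᵐᵒᵖ] P₀}
    {π : P₀ →ₗ[Rᵐᵒᵖ] (ι →₀ Q)} (hex : Function.Exact α π) (hπ : Function.Surjective π)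
    (hα : genClass Q ≤ dClass α) (φ : Rᵐᵒᵖ →ₗ[Rᵐᵒᵖ] P₀)
    (hφ : ∀ X : RightMod R, genClass Q X → ∀ g : Rᵐᵒᵖ →ₗ[Rᵐᵒᵖ] X,
      ∃ f : (ι →₀ Q) →ₗ[Rᵐᵒᵖ] X, f.comp (π.comp φ) = g) :
    dClass (P₁ := ModuleCat.of Rᵐᵒᵖ (Rᵐᵒᵖ × P₁)) (φ.coprod α) = genClass Q := by
  refine le_antisymm (fun X hX => ?_) (fun X hX g => ?_)
  · rw [genClass_iff_iSup_range_eq_top, eq_top_iff]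
    intro x _
    obtain ⟨f, hf⟩ := hX ((LinearMap.toSpanSingleton Rᵐᵒᵖ X x).coprod (0 : P₁ →ₗ[Rᵐᵒᵖ] X))
    have h1 : f (φ 1) = x := by simpa using LinearMap.congr_fun hf ((1, 0) : Rᵐᵒᵖ × P₁)
    have h2 : ∀ z, f (α z) = 0 := fun z => by
      simpa using LinearMap.congr_fun hf ((0, z) : Rᵐᵒᵖ × P₁)
    have hker : LinearMap.ker π ≤ LinearMap.ker f := by
      intro y hy
      obtain ⟨z, rfl⟩ := (hex y).1 hy
      exact h2 z
    obtain ⟨u, hu⟩ := exists_factorization_of_ker_le hπ f hker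
    exact range_le_iSup_range_of_genClass (genClass_finsupp Q ι) u ⟨π (φ 1), (hu _).trans h1⟩
  · obtain ⟨h, hh⟩ := hα X hX (g.comp (LinearMap.inr Rᵐᵒᵖ Rᵐᵒᵖ P₁))
    obtain ⟨f, hf⟩ := hφ X hX (g.comp (LinearMap.inl Rᵐᵒᵖ Rᵐᵒᵖ P₁) - h.comp φ)
    refine ⟨h + f.comp π, LinearMap.ext ?_⟩
    rintro ⟨r, z⟩
    have e1 := LinearMap.congr_fun hh z
    have e2 := LinearMap.congr_fun hf r
    have e3 : g (r, z) = g (r, 0) + g (0, z) := by rw [← map_add]; congr 1; ext <;> simp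
    simp only [LinearMap.comp_apply, LinearMap.inl_apply, LinearMap.inr_apply,
      LinearMap.sub_apply] at e1 e2
    simp only [LinearMap.comp_apply, LinearMap.coprod_apply, LinearMap.add_apply, map_add, e1, e2,
      e3, hex.apply_apply_eq_zero, map_zero, add_zero]
    abel

theorem exists_isSilting_of_isQuasiTilting (hR : IsRightHereditary R ∨ IsRightPerfect R)
    {Q : RightMod R} (hfin : IsFinendo Q) (hQ : IsQuasiTilting Q) :
    ∃ T : RightMod R, IsSilting T ∧ addClass Q = addClass T ∧ genClass Q = genClass T := by
  obtain ⟨P₁, P₀, α, hα, hαD⟩ := exists_presentation_genClass_le_dClass hR hQ.2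
  obtain ⟨ι, hι, φ, hφ⟩ := hfin.exists_preenvelope
  have hα' := hα.finsupp ι
  have hαD' : genClass Q ≤ dClass (P₁ := ModuleCat.of Rᵐᵒᵖ (ι →₀ P₁))
      (P₀ := ModuleCat.of Rᵐᵒᵖ (ι →₀ P₀)) (Finsupp.mapRange.linearMap α) :=
    fun X hX => (dClass_mapRange_iff α ι X).2 (hαD X hX)
  obtain ⟨hP₁, hP₀, π, hex, hπ⟩ := id hα'
  obtain ⟨ψ, rfl⟩ := Module.projective_lifting_property π φ hπ
  have hσ₁ := IsProjectivePresentation.coprod (P := ModuleCat.of Rᵐᵒᵖ Rᵐᵒᵖ) hP₁ hP₀ hex hπ ψ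
  have hσ₁D := dClass_coprod_eq hex hπ hαD' ψ hφ
  let C : RightMod R := ModuleCat.of Rᵐᵒᵖ ((ι →₀ Q) ⧸ LinearMap.range (π.comp ψ))
  let T : RightMod R := ModuleCat.of Rᵐᵒᵖ ((ι →₀ Q) × C)
  have hCgen : genClass Q C :=
    genClass_of_surjective (Submodule.mkQ _) (Submodule.mkQ_surjective _) (genClass_finsupp Q ι)
  have hCadd : addClass Q C :=
    addClass_of_genClass hQ.1 hCgen (hσ₁D.symm.le.trans (dClass_le_rightPerpClass hσ₁))
  have hTQ : addClass Q T :=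
    addClass_prod (X := ModuleCat.of Rᵐᵒᵖ (ι →₀ Q)) (addClass_finsupp (addClass_self Q) ι) hCadd
  obtain ⟨i⟩ := id hι
  have hQT : addClass T Q := by
    refine addClass_of_retraction (Y := T)
      ((LinearMap.inl Rᵐᵒᵖ (ι →₀ Q) C).comp (Finsupp.lsingle i))
      ((Finsupp.lapply i).comp (LinearMap.fst Rᵐᵒᵖ (ι →₀ Q) C)) ?_ (addClass_self T)
    exact LinearMap.ext fun x => Finsupp.single_eq_same
  have hgen : genClass Q = genClass T := by
    refine le_antisymm (genClass_le_of_genClass ?_) (genClass_le_of_genClass ?_)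
    · exact genClass_of_surjective (X := T) ((Finsupp.lapply i).comp (LinearMap.fst Rᵐᵒᵖ (ι →₀ Q) C))
        (fun x => ⟨(Finsupp.single i x, 0), Finsupp.single_eq_same⟩) (genClass_self T)
    · obtain ⟨κ, e, r, hr⟩ := addClass_iff_exists_retraction.1 hTQ
      exact ⟨κ, r, fun x => ⟨e x, LinearMap.congr_fun hr x⟩⟩
  have hσ := hα'.prod hσ₁
  -- Intersecting with the class of the first summand changes nothing, since that class already
  -- contains Gen(Q).
  have hD : dClass (P₁ := ModuleCat.of Rᵐᵒᵖ ((ι →₀ P₁) × Rᵐᵒᵖ × (ι →₀ P₁)))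
      (P₀ := ModuleCat.of Rᵐᵒᵖ ((ι →₀ P₀) × (ι →₀ P₀)))
      ((Finsupp.mapRange.linearMap α).prodMap (ψ.coprod (Finsupp.mapRange.linearMap α))) =
      genClass T := by
    rw [← hgen]
    ext X
    refine (dClass_prodMap_iff (P₁ := ModuleCat.of Rᵐᵒᵖ (ι →₀ P₁))
      (P₀ := ModuleCat.of Rᵐᵒᵖ (ι →₀ P₀))
      (P₁' := ModuleCat.of Rᵐᵒᵖ (Rᵐᵒᵖ × (ι →₀ P₁)))
      (P₀' := ModuleCat.of Rᵐᵒᵖ (ι →₀ P₀)) _ _ X).trans ?_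
    rw [hσ₁D]
    exact ⟨fun h => h.2, fun h => ⟨hαD' X h, h⟩⟩
  have := hσ.2.1
  refine ⟨T, ⟨_, _, _, ⟨hσ, isTorsionClass_of_dClass_eq_genClass hD, ?_⟩, hD⟩,
    le_antisymm (addClass_le_of_addClass hQT) (addClass_le_of_addClass hTQ), hgen⟩
  exact hD.symm.le T (genClass_self T)

end

theorem mainTheorem7 (R : Type u) [Ring R] (hR : IsRightHereditary R ∨ IsRightPerfect R) :
    (∀ Q : RightMod R, IsFinendo Q → IsQuasiTilting Q →
      ∃ T : RightMod R, IsSilting T ∧ addClass Q = addClass T) ∧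
    (∀ 𝒯 : ObjectProperty (RightMod R), IsTorsionClass 𝒯 →
      ((∃ T : RightMod R, IsSilting T ∧ 𝒯 = genClass T) ↔
        (∃ Q : RightMod R, IsFinendo Q ∧ IsQuasiTilting Q ∧ 𝒯 = genClass Q))) := by
  refine ⟨fun Q hfin hQ => ?_, fun 𝒯 _ => ⟨?_, ?_⟩⟩
  · obtain ⟨T, hT, hadd, -⟩ := exists_isSilting_of_isQuasiTilting hR hfin hQ
    exact ⟨T, hT, hadd⟩
  · rintro ⟨T, hT, h⟩
    exact ⟨T, hT.isFinendo, hT.isQuasiTilting, h⟩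
  · rintro ⟨Q, hfin, hQ, h⟩
    obtain ⟨T, hT, -, hgen⟩ := exists_isSilting_of_isQuasiTilting hR hfin hQ
    exact ⟨T, hT, h.trans hgen⟩
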